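/- Let $n\ge 1$ be an integer, let $\zeta_n\in\mathbb{C}$ be a primitive $n$-th root of unity, and let $t,u_1,u_2,u_3$ be formal variables. For a multi-index $\mathbf{p}=(p_1,\ldots,p_d)$ of positive integers put $$\overline{z}_n(\mathbf{p};\zeta_n)=\sum_{n>m_1>\cdots>m_d>0}\ \prod_{i=1}^{d}\frac{\zeta_n^{(p_i-1)m_i}}{(1-\zeta_n^{m_i})^{p_i}},$$ and for a multi-index $\mathbf{k}=(k_1,\ldots,k_l)$ of positive integers put $$\overline{z}_n^{\,t}(\mathbf{k};\zeta_n)=\sum_{\mathbf{p}}\overline{z}_n(\mathbf{p};\zeta_n)\,t^{\,l-\mathrm{dep}(\mathbf{p})}\in\mathbb{C}[t],$$ where $\mathbf{p}$ runs over all $\mathbf{p}=(k_1\Box\cdots\Box k_l)$, one for each of the $3^{l-1}$ ways of filling every $\Box$ by "$,$", "$+$" or "$-1+$", and $\mathrm{dep}(\mathbf{p})$ is the number of entries of $\mathbf{p}$. For integers $k,l,s\ge 0$ let $G_n^t(k,l,s;\zeta_n)$ be the sum of $\overline{z}_n^{\,t}(\mathbf{k};\zeta_n)$ over all multi-indices $\mathbf{k}=(k_1,\ldots,k_l)$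 of positive integers with $k_1+\cdots+k_l=k$ and exactly $s$ entries $k_j\ge 2$; it is $0$ if there is no such $\mathbf{k}$, and $G_n^t(0,0,0;\zeta_n)=1$. Let $$U_n^t(u_1,u_2,u_3)=\sum_{\substack{a,b\ge 0\\ a+b\le n-1}}\frac{1}{n-a-b}\binom{n-a-1}{b}\binom{n-b-1}{a}\,t^{n-a-b-1}(1+u_1)^a(1-tu_2)^b(u_3-u_1u_2)^{n-a-b-1},$$ and let $U_n^{t-1}$ be obtained from $U_n^t$ by replacing $t$ by $t-1$. Then $U_n^t(u_1,u_2,u_3)$ is invertible in the ring of formal power series $\mathbb{C}[t][[u_1,u_2,u_3]]$, and in this ring $$\sum_{k,l,s\ge 0}G_n^t(k,l,s;\zeta_n)\,u_1^{k-l-s}u_2^{l-s}u_3^{s}=\frac{U_n^{t-1}(u_1,u_2,u_3)}{U_n^t(u_1,u_2,u_3)}.$$ -/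

import Mathlib

namespace InterpolatedHarmonic

open Polynomial

/-- The finite sets of strictly decreasing tuples `n > m₁ > ⋯ > m_l > 0`. -/
def decTuples (n l : ℕ) : Finset (Fin l → ℕ) :=
  (Fintype.piFinset fun _ : Fin l => Finset.Ioo 0 n).filter fun m => ∀ i j, i < j → m j < m i

/-- The modified finite multiple harmonic `q`-series
`∑_{n > m₁ > ⋯ > m_l > 0} ∏ᵢ q ^ ((kᵢ - 1) mᵢ) / (1 - q ^ mᵢ) ^ kᵢ`
of a multi-index `k = (k₁, …, k_l)` of positive integers, given as a list.
The value at the empty multi-index is `1`. -/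
noncomputable def zBar (n : ℕ) (k : List ℕ) (q : ℂ) : ℂ :=
  ∑ m ∈ decTuples n k.length,
    ∏ i : Fin k.length, q ^ ((k.get i - 1) * m i) / (1 - q ^ m i) ^ k.get i

/-- All the multi-indices `(a □ k₁ □ ⋯ □ k_l)`, one for each way of filling every box by
a comma, by `+`, or by `-1+` (so with multiplicity). -/
def fillFrom : ℕ → List ℕ → List (List ℕ)
  | a, [] => [[a]]
  | a, b :: k =>
    (fillFrom b k).map (fun p => a :: p) ++ fillFrom (a + b) k ++ fillFrom (a - 1 + b) k

/-- All the multi-indices `(k₁ □ ⋯ □ k_l)`, one for each way of filling every box by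
a comma, by `+`, or by `-1+` (so with multiplicity). -/
def fillings : List ℕ → List (List ℕ)
  | [] => [[]]
  | a :: k => fillFrom a k

/-- The modified interpolated finite multiple harmonic `q`-series, a polynomial in the formal
parameter `t = X`: the sum of `zBar n p q * t ^ (l - dep p)` over all fillings
`p = (k₁ □ ⋯ □ k_l)`. -/
noncomputable def zBarT (n : ℕ) (k : List ℕ) (q : ℂ) : ℂ[X] :=
  ((fillings k).map fun p => C (zBar n p q) * X ^ (k.length - p.length)).sum

/-- The multi-indices of positive integers of weight `k`, depth `l` and (1-)height `s`, the
height being the number of entries that are at least `2`. -/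
def indexSet (k l s : ℕ) : Finset (Fin l → ℕ) :=
  (Finset.Nat.antidiagonalTuple l k).filter fun κ =>
    (∀ i, 1 ≤ κ i) ∧ (Finset.univ.filter fun i => 2 ≤ κ i).card = s

/-- The sum of the modified interpolated series over all multi-indices of weight `k`, depth `l`
and height `s`. -/
noncomputable def G (n k l s : ℕ) (q : ℂ) : ℂ[X] :=
  ∑ κ ∈ indexSet k l s, zBarT n (List.ofFn κ) q

/-- The variables `u₁, u₂, u₃` of the ring of formal power series over `ℂ[t]`
are `u 0, u 1, u 2`. -/
noncomputable abbrev u (i : Fin 3) : MvPowerSeries (Fin 3) ℂ[X] := MvPowerSeries.X i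

/-- The generating function `∑_{k,l,s ≥ 0} G(k,l,s) u₁^(k-l-s) u₂^(l-s) u₃^s`, a formal power
series summed coefficient by coefficient. The exponents are genuine wherever `G(k,l,s)` is not
zero (`G_eq_zero`), and every coefficient gets at most one non-zero contribution
(`coeff_Psi`). -/
noncomputable def Psi (n : ℕ) (q : ℂ) : MvPowerSeries (Fin 3) ℂ[X] := fun e =>
  ∑ᶠ p : ℕ × ℕ × ℕ, MvPowerSeries.coeff e
    (MvPowerSeries.C (G n p.1 p.2.1 p.2.2 q) *
      u 0 ^ (p.1 - p.2.1 - p.2.2) * u 1 ^ (p.2.1 - p.2.2) * u 2 ^ p.2.2)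

/-- The power series (in fact polynomial) `U_n^t(u₁, u₂, u₃)`; the parameter `t` is an argument,
so that `t` may be replaced by `t - 1`. -/
noncomputable def U (n : ℕ) (t : ℂ[X]) : MvPowerSeries (Fin 3) ℂ[X] :=
  ∑ p ∈ (Finset.range n ×ˢ Finset.range n).filter (fun p => p.1 + p.2 ≤ n - 1),
    MvPowerSeries.C
        (C (1 / ((n : ℂ) - p.1 - p.2) * (n - p.1 - 1).choose p.2 * (n - p.2 - 1).choose p.1) *
          t ^ (n - p.1 - p.2 - 1)) *
      (1 + u 0) ^ p.1 * (1 - MvPowerSeries.C t * u 1) ^ p.2 *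
        (u 2 - u 0 * u 1) ^ (n - p.1 - p.2 - 1)

/-- `G(0,0,0) = 1`. -/
theorem G_zero (n : ℕ) (q : ℂ) : G n 0 0 0 q = 1 := by
  simp [G, indexSet, zBarT, fillings, zBar, decTuples]

/-- `G(k,l,s) = 0` unless `s ≤ l` and `l + s ≤ k`. -/
theorem G_eq_zero (n k l s : ℕ) (q : ℂ) (h : ¬ (s ≤ l ∧ l + s ≤ k)) : G n k l s q = 0 := by
  have : indexSet k l s = ∅ := by
    rw [Finset.eq_empty_iff_forall_notMem]
    intro κ hκ
    apply h
    simp only [indexSet, Finset.mem_filter, Finset.Nat.mem_antidiagonalTuple] at hκ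
    obtain ⟨hk, hpos, hs⟩ := hκ
    constructor
    · rw [← hs]
      simpa using Finset.card_le_univ (Finset.univ.filter fun i => 2 ≤ κ i)
    · have h1 : ∑ i : Fin l, (1 + if 2 ≤ κ i then 1 else 0) ≤ ∑ i, κ i := by
        apply Finset.sum_le_sum
        intro i _
        have := hpos i
        split_ifs <;> omega
      rw [Finset.sum_add_distrib, ← Finset.card_filter, hs, hk] at h1
      simpa using h1
  simp [G, this]

/-- The coefficient of `u₁^(e 0) u₂^(e 1) u₃^(e 2)` in the generating function is the single
`G(k,l,s)` with `k - l - s = e 0`, `l - s = e 1`, `s = e 2`. -/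
theorem coeff_Psi (n : ℕ) (q : ℂ) (e : Fin 3 →₀ ℕ) :
    MvPowerSeries.coeff e (Psi n q) = G n (e 0 + e 1 + 2 * e 2) (e 1 + e 2) (e 2) q := by
  have key : ∀ p : ℕ × ℕ × ℕ, MvPowerSeries.coeff e
      (MvPowerSeries.C (G n p.1 p.2.1 p.2.2 q) *
      u 0 ^ (p.1 - p.2.1 - p.2.2) * u 1 ^ (p.2.1 - p.2.2) * u 2 ^ p.2.2) =
      if e 0 = p.1 - p.2.1 - p.2.2 ∧ e 1 = p.2.1 - p.2.2 ∧ e 2 = p.2.2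
        then G n p.1 p.2.1 p.2.2 q else 0 := by
    intro p
    rw [mul_assoc, mul_assoc, MvPowerSeries.coeff_C_mul, u, u, u, MvPowerSeries.X_pow_eq,
      MvPowerSeries.X_pow_eq, MvPowerSeries.X_pow_eq, MvPowerSeries.monomial_mul_monomial,
      MvPowerSeries.monomial_mul_monomial, MvPowerSeries.coeff_monomial]
    simp only [Finsupp.ext_iff, Fin.forall_fin_succ]
    simp [Finsupp.single_apply]
  change ∑ᶠ p : ℕ × ℕ × ℕ, _ = _
  rw [finsum_congr key, finsum_eq_single _ (e 0 + e 1 + 2 * e 2, e 1 + e 2, e 2)]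
  · rw [if_pos]
    refine ⟨?_, ?_, rfl⟩
    · change e 0 = e 0 + e 1 + 2 * e 2 - (e 1 + e 2) - e 2
      omega
    · change e 1 = e 1 + e 2 - e 2
      omega
  · rintro ⟨k, l, s⟩ hne
    simp only
    split_ifs with h
    · apply G_eq_zero
      rintro ⟨h1, h2⟩
      apply hne
      simp only [Prod.mk.injEq]
      omega
    · rfl

end InterpolatedHarmonic

/-! Let the truncation level N in n > m₁ > ⋯ vary, with `q` and t fixed, and let Ψ_N be the
generating function at level N. The tuples with m₁ = N contribute Ψ_{N+1} - Ψ_N. With z = q^N, an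
entry a at m = N has factor f(a) = z^(a-1)/(1-z)^a, and f(a+b) + f(a-1+b) = f(a) f(b): the two kinds
of merging together are multiplicative (`factor_merge`). Hence, if W is the generating function of a
single entry at N, the difference D satisfies D = W (Ψ_N + t D) (`topSum_cons`), so that (1 - tW)
Ψ_{N+1} = (1 - (t-1)W) Ψ_N.

Since f is geometric, W is rational, and clearing denominators turns 1 - tW into a quadratic in z
(`quad_eq`). As Ψ_1 = 1, the recursion telescopes: Ψ_n is the quotient of the products of these
quadratics over z = q, …, q^(n-1), for t - 1 and for t.

Such a product over roots of unity is a power sum of the roots of a quadratic, up to elementary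
terms (`prod_quadratic_roots_of_unity`). Expanding the power sum through a logarithmic derivative
(`pow_add_pow_eq_lucasSum`) gives n U_n^t, and the factor n cancels. -/

namespace InterpolatedHarmonic

/-! ### Power sums of the roots of a quadratic -/

section Lucas

open PowerSeries Finset

variable {K : Type*} [Field K]

/-- The geometric series `∑ aⁱ zⁱ = 1 / (1 - a z)`. -/
noncomputable def geom (a : K) : K⟦X⟧ := PowerSeries.mk fun i => a ^ i

theorem geom_mul (a : K) : geom a * (1 - C a * X) = 1 := by
  ext (_ | n)
  · simp [geom]
  · rw [mul_sub, mul_one, map_sub, mul_comm (C a) X, ← mul_assoc, coeff_mul_C, coeff_succ_mul_X]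
    simp [geom, pow_succ, coeff_one]

theorem derivative_geom (a : K) : derivative K (geom a) = C a * geom a ^ 2 := by
  have h := congrArg (derivative K) (geom_mul a)
  have h1 := geom_mul a
  simp only [Derivation.leibniz, map_sub, derivative_C, derivative_X, Derivation.map_one_eq_zero,
    smul_eq_mul, mul_zero, mul_one, add_zero, zero_sub] at h
  linear_combination geom a * h - (derivative K (geom a)) * h1

theorem coeff_geom_pow (a : K) (c i : ℕ) :
    coeff i (geom a ^ (c + 1)) = (c + i).choose c * a ^ i := by
  have h : geom a = rescale a (PowerSeries.mk 1) := by
    ext; simp [geom, coeff_rescale]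
  rw [h, ← map_pow, mk_one_pow_eq_mk_choose_add, coeff_rescale, coeff_mk, mul_comm]

/-- The value at `A`, `B`, `T` of the polynomial
`∑_{a+b ≤ n-1} 1/(n-a-b) * C(n-a-1, b) * C(n-b-1, a) * A^a * B^b * T^(n-a-b-1)`. -/
noncomputable def lucasSum (n : ℕ) (A B T : K) : K :=
  ∑ p ∈ (range n ×ˢ range n).filter (fun p => p.1 + p.2 ≤ n - 1),
    (1 / ((n : K) - p.1 - p.2) * (n - p.1 - 1).choose p.2 * (n - p.2 - 1).choose p.1) *
      A ^ p.1 * B ^ p.2 * T ^ (n - p.1 - p.2 - 1)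

/-- The right side is the n-th coefficient of -log(1 - Y), Y = T X/((1 - AX)(1 - BX)), cut off where
powers of Y no longer matter. The negative binomial series expands each power, with c = n-a-b-1. -/
theorem lucasSum_eq_coeff (n : ℕ) (A B T : K) :
    T * lucasSum n A B T =
      ∑ c ∈ range n, (1 / ((c : K) + 1)) *
        coeff n ((C T * X * (geom A * geom B)) ^ (c + 1)) := by
  have key : ∀ c ∈ range n, (1 / ((c : K) + 1)) *
      coeff n ((C T * X * (geom A * geom B)) ^ (c + 1)) =
      ∑ p ∈ antidiagonal (n - 1 - c), (1 / ((c : K) + 1)) * T ^ (c + 1) *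
        ((c + p.1).choose c * A ^ p.1 * ((c + p.2).choose c * B ^ p.2)) := by
    intro c hc
    have hc' : n = (n - 1 - c) + (c + 1) := by have := mem_range.1 hc; omega
    rw [mul_pow, mul_pow, mul_pow, ← map_pow, mul_assoc, coeff_C_mul]
    nth_rw 1 [hc']
    rw [coeff_X_pow_mul, coeff_mul, mul_sum, mul_sum]
    refine sum_congr rfl fun p _ => ?_
    rw [coeff_geom_pow, coeff_geom_pow]
    ring
  rw [sum_congr rfl key, sum_sigma', lucasSum, mul_sum]
  refine sum_bij' (fun p _ => ⟨n - 1 - p.1 - p.2, p⟩) (fun x _ => x.2) ?_ ?_ ?_ ?_ ?_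
  · intro p hp
    simp only [mem_filter, mem_product, mem_range, mem_sigma, HasAntidiagonal.mem_antidiagonal] at hp ⊢
    omega
  · rintro ⟨c, p⟩ hp
    simp only [mem_filter, mem_product, mem_range, mem_sigma, HasAntidiagonal.mem_antidiagonal] at hp ⊢
    omega
  · intros; rfl
  · rintro ⟨c, p⟩ hp
    simp only [mem_sigma, mem_range, HasAntidiagonal.mem_antidiagonal] at hp
    have : n - 1 - p.1 - p.2 = c := by omega
    simp [this]
  · rintro ⟨a, b⟩ hp
    simp only [mem_filter, mem_product, mem_range] at hp
    obtain ⟨c, rfl⟩ : ∃ c, n = a + b + c + 1 := ⟨n - 1 - a - b, by omega⟩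
    have h1 : a + b + c + 1 - 1 - a - b = c := by omega
    have h2 : a + b + c + 1 - a - b - 1 = c := by omega
    have h3 : a + b + c + 1 - a - 1 = c + b := by omega
    have h4 : a + b + c + 1 - b - 1 = c + a := by omega
    have h5 : ((a + b + c + 1 : ℕ) : K) - a - b = c + 1 := by push_cast; ring
    simp only [h1, h2, h3, h4, h5]
    rw [Nat.choose_symm_add (a := c) (b := b), Nat.choose_symm_add (a := c) (b := a)]
    ring

/-- The power sums of two numbers with sum `A + B + T` and product `A * B`. -/
theorem pow_add_pow_eq_lucasSum [CharZero K] (n : ℕ) {A B T x y : K} (hs : x + y = A + B + T)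
    (hp : x * y = A * B) :
    x ^ n + y ^ n = A ^ n + B ^ n + n * (T * lucasSum n A B T) := by
  set Y : K⟦X⟧ := C T * X * (geom A * geom B) with hY
  have e1 : C x + C y = C A + C B + (C T : K⟦X⟧) := by simp only [← map_add, hs]
  have e2 : C x * C y = C A * (C B : K⟦X⟧) := by simp only [← map_mul, hp]
  have hA := geom_mul A
  have hB := geom_mul B
  have hx := geom_mul x
  have hy := geom_mul y
  have hdY : derivative K Y = C T * (geom A * geom B) +
      C T * X * (C A * geom A ^ 2 * geom B + C B * geom A * geom B ^ 2) := by
    simp only [hY, Derivation.leibniz, derivative_C, derivative_X, derivative_geom, smul_eq_mul]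
    ring
  -- As x, y have sum A + B + T and product AB, 1 - Y = (1 - xX)(1 - yX)/((1 - AX)(1 - BX)).
  have h1Y : 1 - Y = geom A * geom B * ((1 - C x * X) * (1 - C y * X)) := by
    linear_combination (-geom B * (1 - C B * X)) * hA - hB + (geom A * geom B * X) * e1
      - (geom A * geom B * X ^ 2) * e2
  set S : K⟦X⟧ := geom x + geom y - geom A - geom B with hS
  -- Logarithmic derivative of the factorisation of 1 - Y; the n-th coefficient of S is the wanted
  -- difference of power sums.
  have hmain : X * derivative K Y = (1 - Y) * S := by
    have h2 : (1 - Y) * (geom x + geom y) =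
        geom A * geom B * ((1 - C x * X) + (1 - C y * X)) := by
      rw [h1Y]
      linear_combination (geom A * geom B * (1 - C y * X)) * hx
        + (geom A * geom B * (1 - C x * X)) * hy
    have h3 : X * derivative K Y = geom A * geom B * ((1 - C x * X) + (1 - C y * X))
        - (1 - Y) * (geom A + geom B) := by
      rw [hdY, hY]
      linear_combination (-geom B - C T * X * geom A * geom B) * hA
        + (-geom A - C T * X * geom A * geom B) * hB + (geom A * geom B * X) * e1
    rw [h3, hS]
    linear_combination -h2
  have hgeom : (1 - Y) * ∑ i ∈ range n, Y ^ i = 1 - Y ^ n := by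
    have := mul_neg_geom_sum Y n
    exact this
  -- Truncating the geometric series in Y is harmless: X^n divides Y^n and S has constant term 0.
  have hcoef : coeff n (S * Y ^ n) = 0 := by
    have : S * Y ^ n = X ^ n * (S * (C T * (geom A * geom B)) ^ n) := by
      rw [hY]; ring
    rw [this]
    have h0 := coeff_X_pow_mul (S * (C T * (geom A * geom B)) ^ n) n 0
    rw [zero_add] at h0
    rw [h0]
    simp [hS, geom]
  have hsum : X * derivative K Y * ∑ i ∈ range n, Y ^ i = S - S * Y ^ n := by
    rw [hmain]
    linear_combination S * hgeom
  have hc := congrArg (coeff n) hsum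
  rw [map_sub, hcoef, sub_zero] at hc
  have hSn : coeff n S = x ^ n + y ^ n - A ^ n - B ^ n := by simp [hS, geom]
  have hterm : ∀ c : ℕ, coeff n (X * derivative K Y * Y ^ c) =
      n * ((1 / ((c : K) + 1)) * coeff n (Y ^ (c + 1))) := by
    intro c
    have hd : derivative K (Y ^ (c + 1)) = C ((c : K) + 1) * (derivative K Y * Y ^ c) := by
      rw [Derivation.leibniz_pow]
      simp only [smul_eq_mul, nsmul_eq_mul, map_add, map_one, map_natCast]
      push_cast
      ring
    have hc1 : (c : K) + 1 ≠ 0 := by exact_mod_cast c.succ_ne_zero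
    rcases n with _ | m
    · simp
    · have h := congrArg (coeff m) hd
      rw [coeff_derivative, coeff_C_mul] at h
      rw [mul_assoc, coeff_succ_X_mul]
      push_cast
      field_simp
      linear_combination -h
  rw [lucasSum_eq_coeff, mul_sum, ← sum_congr rfl fun c _ => hterm c, ← map_sum, ← mul_sum, hc, hSn]
  ring

end Lucas

/-! ### Products of a quadratic over roots of unity -/

section RootsOfUnity

open Finset

theorem prod_range_sub_pow_mul {K : Type*} [Field K] {n : ℕ} (hn : 0 < n) {ζ : K}
    (h : IsPrimitiveRoot ζ n) (x y : K) :
    ∏ i ∈ range n, (x - ζ ^ i * y) = x ^ n - y ^ n := by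
  rw [h.pow_sub_pow_eq_prod_sub_mul x y hn]
  refine prod_bij (fun i _ => ζ ^ i) ?_ ?_ ?_ ?_
  · intro i _
    rw [Polynomial.mem_nthRootsFinset hn, ← pow_mul, mul_comm, pow_mul, h.pow_eq_one, one_pow]
  · intro i hi j hj hij
    exact h.pow_inj (mem_range.1 hi) (mem_range.1 hj) hij
  · intro z hz
    have : NeZero n := ⟨hn.ne'⟩
    obtain ⟨i, hi, rfl⟩ := h.eq_pow_of_pow_eq_one ((Polynomial.mem_nthRootsFinset hn _).1 hz)
    exact ⟨i, mem_range.2 hi, rfl⟩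
  · intros; rfl

/-- With x + y = A + B + T and xy = AB, A times the quadratic at ζ^i is (x - ζ^i A)(y - ζ^i A), so
the full product over i is A^n + B^n - x^n - y^n. The factor at i = 0 is -T, which is cancelled at
the end. -/
theorem prod_quadratic_roots_of_unity {K : Type*} [Field K] [CharZero K] [IsAlgClosed K] {n : ℕ}
    (hn : 1 ≤ n) {ζ : K} (h : IsPrimitiveRoot ζ n) {A B T : K} (hA : A ≠ 0) (hT : T ≠ 0) :
    ∏ i ∈ Ico 1 n, (A * (ζ ^ i) ^ 2 - (A + B + T) * ζ ^ i + B) = n * lucasSum n A B T := by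
  obtain ⟨x, hx⟩ : ∃ x : K, x * x - (A + B + T) * x + A * B = 0 := by
    obtain ⟨s, hs⟩ := IsAlgClosed.exists_pow_nat_eq ((A + B + T) ^ 2 - 4 * (A * B)) (n := 2)
      two_pos
    exact ⟨(A + B + T + s) / 2, by linear_combination hs / 4⟩
  obtain ⟨y, hy⟩ : ∃ y : K, y = A + B + T - x := ⟨_, rfl⟩
  have hs : x + y = A + B + T := by rw [hy]; ring
  have hp : x * y = A * B := by rw [hy]; linear_combination -hx
  have hprod : ∏ i ∈ range n, (A * (ζ ^ i) ^ 2 - (A + B + T) * ζ ^ i + B) =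
      A ^ n + B ^ n - (x ^ n + y ^ n) := by
    apply mul_left_cancel₀ (pow_ne_zero n hA)
    have h1 : A ^ n = ∏ i ∈ range n, A := by simp
    have h2 : x ^ n * y ^ n = A ^ n * B ^ n := by rw [← mul_pow, hp, mul_pow]
    have h3 : A ^ n * ∏ i ∈ range n, (A * (ζ ^ i) ^ 2 - (A + B + T) * ζ ^ i + B) =
        (∏ i ∈ range n, (x - ζ ^ i * A)) * ∏ i ∈ range n, (y - ζ ^ i * A) := by
      rw [h1, ← prod_mul_distrib, ← prod_mul_distrib]
      refine prod_congr rfl fun i _ => ?_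
      linear_combination -hp + A * ζ ^ i * hs
    rw [h3, prod_range_sub_pow_mul hn h, prod_range_sub_pow_mul hn h]
    linear_combination h2
  rw [pow_add_pow_eq_lucasSum n hs hp, range_eq_Ico, prod_eq_prod_Ico_succ_bot hn] at hprod
  apply mul_left_cancel₀ hT
  simp only [pow_zero, zero_add] at hprod
  linear_combination -hprod

end RootsOfUnity

end InterpolatedHarmonic

/-! ### Recursion in the truncation level -/

namespace InterpolatedHarmonic

open Polynomial

/-- The factor `q ^ ((p - 1) m) / (1 - q ^ m) ^ p` of the harmonic `q`-series. -/
noncomputable def factor (q : ℂ) (m p : ℕ) : ℂ := q ^ ((p - 1) * m) / (1 - q ^ m) ^ p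

/-- With z = q^m, this is z^(a+b-2) (z + (1 - z))/(1 - z)^(a+b); it explains the box `-1+`. -/
theorem factor_merge {q : ℂ} {m : ℕ} (h : q ^ m ≠ 1) {a b : ℕ} (ha : 1 ≤ a) (hb : 1 ≤ b) :
    factor q m (a + b) + factor q m (a - 1 + b) = factor q m a * factor q m b := by
  obtain ⟨a, rfl⟩ := Nat.exists_eq_add_of_le' ha
  obtain ⟨b, rfl⟩ := Nat.exists_eq_add_of_le' hb
  have h1 : 1 - q ^ m ≠ 0 := sub_ne_zero.2 h.symm
  have e1 : a + 1 + (b + 1) - 1 = a + b + 1 := by omega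
  have e2 : a + 1 - 1 + (b + 1) - 1 = a + b := by omega
  have e3 : a + 1 - 1 + (b + 1) = a + b + 1 := by omega
  rw [factor, factor, factor, factor, e1, e2, e3, Nat.add_sub_cancel, Nat.add_sub_cancel]
  simp only [mul_comm _ m, pow_mul]
  field_simp
  ring

theorem sum_decTuples_succ {N l : ℕ} (hN : 1 ≤ N) (F : (Fin (l + 1) → ℕ) → ℂ) :
    ∑ m ∈ decTuples (N + 1) (l + 1), F m =
      ∑ m ∈ decTuples N (l + 1), F m + ∑ m ∈ decTuples N l, F (Fin.cons N m) := by
  rw [← Finset.sum_filter_add_sum_filter_not (decTuples (N + 1) (l + 1)) (fun m => m 0 ≠ N)]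
  congr 1
  · refine Finset.sum_congr ?_ fun _ _ => rfl
    ext m
    simp only [decTuples, Finset.mem_filter, Fintype.mem_piFinset, Finset.mem_Ioo]
    constructor
    · rintro ⟨⟨h1, h2⟩, h3⟩
      refine ⟨fun i => ⟨(h1 i).1, ?_⟩, h2⟩
      have h0 := (h1 0).2
      rcases Fin.eq_zero_or_eq_succ i with rfl | ⟨j, rfl⟩
      · omega
      · have := h2 0 j.succ (Fin.succ_pos j)
        omega
    · rintro ⟨h1, h2⟩
      refine ⟨⟨fun i => ⟨(h1 i).1, ?_⟩, h2⟩, ?_⟩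
      · have := (h1 i).2
        omega
      · have := (h1 0).2
        omega
  · refine Finset.sum_bij' (fun m _ => Fin.tail m) (fun m _ => Fin.cons N m) ?_ ?_ ?_ ?_ ?_
    · intro m hm
      simp only [decTuples, Finset.mem_filter, Fintype.mem_piFinset, Finset.mem_Ioo,
        not_not] at hm ⊢
      obtain ⟨⟨h1, h2⟩, h3⟩ := hm
      refine ⟨fun i => ⟨(h1 i.succ).1, ?_⟩, fun i j hij => h2 _ _ (Fin.succ_lt_succ_iff.2 hij)⟩
      rw [← h3]
      exact h2 _ _ (Fin.succ_pos i)
    · intro m hm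
      simp only [decTuples, Finset.mem_filter, Fintype.mem_piFinset, Finset.mem_Ioo,
        not_not] at hm ⊢
      obtain ⟨h1, h2⟩ := hm
      refine ⟨⟨fun i => ?_, fun i j hij => ?_⟩, rfl⟩
      · rcases Fin.eq_zero_or_eq_succ i with rfl | ⟨j, rfl⟩
        · simp only [Fin.cons_zero]
          omega
        · have := h1 j
          simp only [Fin.cons_succ]
          omega
      · rcases Fin.eq_zero_or_eq_succ j with rfl | ⟨j, rfl⟩
        · exact absurd hij (Fin.not_lt_zero i)
        · rcases Fin.eq_zero_or_eq_succ i with rfl | ⟨i, rfl⟩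
          · simpa using (h1 j).2
          · simpa using h2 i j (Fin.succ_lt_succ_iff.1 hij)
    · intro m hm
      simp only [Finset.mem_filter, not_not] at hm
      rw [← hm.2]
      exact Fin.cons_self_tail m
    · intro m _
      exact Fin.tail_cons _ _
    · intro m hm
      simp only [Finset.mem_filter, not_not] at hm
      rw [← hm.2, Fin.cons_self_tail]

theorem zBar_nil (N : ℕ) (q : ℂ) : zBar N [] q = 1 := by
  simp [zBar, decTuples]

theorem zBar_one_cons (p : ℕ) (k : List ℕ) (q : ℂ) : zBar 1 (p :: k) q = 0 := by
  apply Finset.sum_eq_zero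
  intro m hm
  simp only [decTuples, Finset.mem_filter, Fintype.mem_piFinset, Finset.mem_Ioo] at hm
  have := hm.1 ⟨0, Nat.succ_pos _⟩
  omega

theorem zBar_succ_cons {N : ℕ} (hN : 1 ≤ N) (p : ℕ) (k : List ℕ) (q : ℂ) :
    zBar (N + 1) (p :: k) q = zBar N (p :: k) q + factor q N p * zBar N k q := by
  refine (sum_decTuples_succ (l := k.length) hN _).trans ?_
  congr 1
  rw [zBar, Finset.mul_sum]
  refine Finset.sum_congr rfl fun m _ => ?_
  exact Fin.prod_univ_succ _

/-- The contribution of the tuples whose first entry is `N` to the interpolated series of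
`a :: k`. -/
noncomputable def headSum (N : ℕ) (q : ℂ) (a : ℕ) (k : List ℕ) : ℂ[X] :=
  ((fillFrom a k).map fun p =>
    C (factor q N p.headI * zBar N p.tail q) * X ^ (k.length + 1 - p.length)).sum

theorem length_of_mem_fillFrom {a : ℕ} {k p : List ℕ} (hp : p ∈ fillFrom a k) :
    1 ≤ p.length ∧ p.length ≤ k.length + 1 := by
  induction k generalizing a p with
  | nil => simp_all [fillFrom]
  | cons b k ih =>
    simp only [fillFrom, List.mem_append, List.mem_map] at hp
    rcases hp with (⟨p, hp, rfl⟩ | hp) | hp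
    · have := ih hp
      simp only [List.length_cons]
      omega
    · have := ih hp
      simp only [List.length_cons]
      omega
    · have := ih hp
      simp only [List.length_cons]
      omega

theorem sum_map_fillFrom_shift (a : ℕ) (k : List ℕ) (F : List ℕ → ℂ) :
    ((fillFrom a k).map fun p => C (F p) * X ^ (k.length + 1 + 1 - p.length)).sum =
      X * ((fillFrom a k).map fun p => C (F p) * X ^ (k.length + 1 - p.length)).sum := by
  rw [← List.sum_map_mul_left]
  congr 1
  refine List.map_congr_left fun p hp => ?_
  have := length_of_mem_fillFrom hp
  rw [show k.length + 1 + 1 - p.length = (k.length + 1 - p.length) + 1 by omega, pow_succ]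
  ring

theorem headSum_nil (N : ℕ) (q : ℂ) (a : ℕ) : headSum N q a [] = C (factor q N a) := by
  simp [headSum, fillFrom, zBar_nil]

/-- Sort by the first box: a comma frees the remaining indices to run below N, while either merging
lowers the depth and costs one t. -/
theorem headSum_cons_eq (N : ℕ) (q : ℂ) (a b : ℕ) (k : List ℕ) :
    headSum N q a (b :: k) = C (factor q N a) * zBarT N (b :: k) q +
      X * (headSum N q (a + b) k + headSum N q (a - 1 + b) k) := by
  rw [headSum, fillFrom, List.map_append, List.map_append, List.sum_append, List.sum_append,
    List.map_map]
  simp only [List.length_cons]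
  rw [sum_map_fillFrom_shift, sum_map_fillFrom_shift, mul_add, add_assoc]
  congr 1
  rw [zBarT, fillings, ← List.sum_map_mul_left]
  congr 1
  refine List.map_congr_left fun p _ => ?_
  simp only [Function.comp, List.headI_cons, List.tail_cons, List.length_cons,
    Nat.add_sub_add_right, C_mul]
  ring

/-- By `factor_merge`, the head entry enters only through its factor. Head 1 is the reference, and 1
- q^N is the inverse of its factor. -/
theorem headSum_eq_mul {N : ℕ} {q : ℂ} (h : q ^ N ≠ 1) {a : ℕ} (ha : 1 ≤ a) (k : List ℕ)
    (hk : ∀ b ∈ k, 1 ≤ b) :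
    headSum N q a k = C (factor q N a) * headSum N q 1 k * C (1 - q ^ N) := by
  have h1 : (1 : ℂ) - q ^ N ≠ 0 := sub_ne_zero.2 h.symm
  have hf : C (factor q N 1) * C (1 - q ^ N) = 1 := by
    rw [← C_mul]
    simp [factor, h1]
  induction k generalizing a with
  | nil =>
    rw [headSum_nil, headSum_nil, mul_assoc, hf, mul_one]
  | cons b k ih =>
    have hb : 1 ≤ b := hk b (by simp)
    have hk' : ∀ b ∈ k, 1 ≤ b := fun c hc => hk c (by simp [hc])
    have hm : ∀ a, 1 ≤ a → C (factor q N (a + b)) + C (factor q N (a - 1 + b)) =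
        C (factor q N a) * C (factor q N b) := by
      intro a ha
      rw [← C_add, ← C_mul, factor_merge h ha hb]
    rw [headSum_cons_eq, headSum_cons_eq, ih (a := a + b) (by omega) hk',
      ih (a := a - 1 + b) (by omega) hk',
      ih (a := 1 + b) (by omega) hk', ih (a := 1 - 1 + b) (by omega) hk']
    linear_combination (X * headSum N q 1 k * C (1 - q ^ N)) * hm a ha
      - (C (factor q N a) * C (1 - q ^ N)) * (X * headSum N q 1 k * C (1 - q ^ N)) * hm 1 le_rfl
      - (C (factor q N a) * zBarT N (b :: k) q + X * headSum N q 1 k * C (1 - q ^ N) *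
        C (factor q N a) * C (factor q N b)) * hf

/-- The part of the interpolated series with first index exactly `N`. -/
noncomputable def topSum (N : ℕ) (q : ℂ) : List ℕ → ℂ[X]
  | [] => 0
  | a :: k => headSum N q a k

theorem topSum_cons {N : ℕ} {q : ℂ} (h : q ^ N ≠ 1) {a : ℕ} (ha : 1 ≤ a) (k : List ℕ)
    (hk : ∀ b ∈ k, 1 ≤ b) :
    topSum N q (a :: k) = C (factor q N a) * (zBarT N k q + X * topSum N q k) := by
  rcases k with _ | ⟨b, k⟩
  · simp [topSum, headSum_nil, zBarT, fillings, zBar_nil]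
  · have hb : 1 ≤ b := hk b (by simp)
    have hk' : ∀ b ∈ k, 1 ≤ b := fun c hc => hk c (by simp [hc])
    have hm : C (factor q N (a + b)) + C (factor q N (a - 1 + b)) =
        C (factor q N a) * C (factor q N b) := by
      rw [← C_add, ← C_mul, factor_merge h ha hb]
    rw [topSum, topSum, headSum_cons_eq, headSum_eq_mul h (a := a + b) (by omega) k hk',
      headSum_eq_mul h (a := a - 1 + b) (by omega) k hk', headSum_eq_mul h hb k hk']
    linear_combination (X * headSum N q 1 k * C (1 - q ^ N)) * hm

theorem zBarT_succ {N : ℕ} (hN : 1 ≤ N) (q : ℂ) (k : List ℕ) :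
    zBarT (N + 1) k q = zBarT N k q + topSum N q k := by
  rcases k with _ | ⟨a, k⟩
  · simp [zBarT, topSum, fillings, zBar_nil]
  · rw [zBarT, zBarT, topSum, headSum, fillings, ← List.sum_map_add]
    congr 1
    refine List.map_congr_left fun p hp => ?_
    have hl := (length_of_mem_fillFrom hp).1
    rcases p with _ | ⟨c, p⟩
    · simp at hl
    · rw [zBar_succ_cons hN, C_add, add_mul]
      rfl

theorem zBarT_one_cons (a : ℕ) (k : List ℕ) (q : ℂ) : zBarT 1 (a :: k) q = 0 := by
  rw [zBarT, fillings]
  apply List.sum_eq_zero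
  intro x hx
  obtain ⟨p, hp, rfl⟩ := List.mem_map.1 hx
  have hl := (length_of_mem_fillFrom hp).1
  rcases p with _ | ⟨c, p⟩
  · simp at hl
  · simp [zBar_one_cons]

theorem zBarT_nil (N : ℕ) (q : ℂ) : zBarT N [] q = 1 := by
  simp [zBarT, fillings, zBar_nil]

end InterpolatedHarmonic

/-! ### Generating functions over multi-indices -/

namespace InterpolatedHarmonic

open Polynomial

/-- The exponent of the monomial in `u₁, u₂, u₃` attached to an entry of a multi-index. -/
noncomputable def entryExp (a : ℕ) : Fin 3 →₀ ℕ :=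
  if 2 ≤ a then Finsupp.single 0 (a - 2) + Finsupp.single 2 1 else Finsupp.single 1 1

/-- The exponent of the monomial in `u₁, u₂, u₃` attached to a multi-index. -/
noncomputable def listExp (k : List ℕ) : Fin 3 →₀ ℕ := (k.map entryExp).sum

theorem listExp_cons (a : ℕ) (k : List ℕ) : listExp (a :: k) = entryExp a + listExp k := by
  simp [listExp]

/-- Depth, weight and height are additive over entries and recoverable from the exponent, so
grouping lists by exponent is the same as grouping by (k, l, s). -/
theorem listExp_spec {k : List ℕ} (hk : ∀ a ∈ k, 1 ≤ a) :
    k.length = listExp k 1 + listExp k 2 ∧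
      k.sum = listExp k 0 + listExp k 1 + 2 * listExp k 2 ∧
      (k.map fun a => if 2 ≤ a then 1 else 0).sum = listExp k 2 := by
  induction k with
  | nil => simp [listExp]
  | cons a k ih =>
    have ha : 1 ≤ a := hk a (by simp)
    obtain ⟨h1, h2, h3⟩ := ih fun b hb => hk b (by simp [hb])
    rw [listExp_cons, List.length_cons, List.sum_cons, List.map_cons, List.sum_cons]
    by_cases h : 2 ≤ a
    · simp [entryExp, h]
      omega
    · simp [entryExp, h]
      omega

/-- The multi-indices of positive integers with exponent `e`, as lists. -/
noncomputable def indexLists (e : Fin 3 →₀ ℕ) : Finset (List ℕ) :=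
  (indexSet (e 0 + e 1 + 2 * e 2) (e 1 + e 2) (e 2)).image List.ofFn

theorem mem_image_ofFn_indexSet {w l s : ℕ} {k : List ℕ} :
    k ∈ (indexSet w l s).image List.ofFn ↔ (∀ a ∈ k, 1 ≤ a) ∧ k.length = l ∧ k.sum = w ∧
      (k.map fun a => if 2 ≤ a then 1 else 0).sum = s := by
  have key : ∀ κ : Fin l → ℕ, κ ∈ indexSet w l s ↔
      (∀ a ∈ List.ofFn κ, 1 ≤ a) ∧ (List.ofFn κ).sum = w ∧
        ((List.ofFn κ).map fun a => if 2 ≤ a then 1 else 0).sum = s := by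
    intro κ
    simp only [indexSet, Finset.mem_filter, Finset.Nat.mem_antidiagonalTuple, List.map_ofFn,
      List.sum_ofFn, List.mem_ofFn', Set.forall_mem_range, Finset.card_filter, Function.comp]
    tauto
  rw [Finset.mem_image]
  constructor
  · rintro ⟨κ, hκ, rfl⟩
    have := (key κ).1 hκ
    exact ⟨this.1, List.length_ofFn, this.2⟩
  · rintro ⟨h1, rfl, h2⟩
    exact ⟨k.get, (key _).2 (by rw [List.ofFn_get]; exact ⟨h1, h2⟩), List.ofFn_get k⟩

theorem mem_indexLists {e : Fin 3 →₀ ℕ} {k : List ℕ} :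
    k ∈ indexLists e ↔ (∀ a ∈ k, 1 ≤ a) ∧ listExp k = e := by
  rw [indexLists, mem_image_ofFn_indexSet]
  refine and_congr_right fun hk => ?_
  obtain ⟨h1, h2, h3⟩ := listExp_spec hk
  rw [h1, h2, h3]
  constructor
  · rintro ⟨h4, h5, h6⟩
    ext i
    fin_cases i
    · change listExp k 0 = e 0
      omega
    · change listExp k 1 = e 1
      omega
    · exact h6
  · rintro rfl
    exact ⟨rfl, rfl, rfl⟩

/-- The generating function of a function on multi-indices. -/
noncomputable def genFun (g : List ℕ → ℂ[X]) : MvPowerSeries (Fin 3) ℂ[X] := fun e =>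
  ∑ k ∈ indexLists e, g k

theorem coeff_genFun (g : List ℕ → ℂ[X]) (e : Fin 3 →₀ ℕ) :
    MvPowerSeries.coeff e (genFun g) = ∑ k ∈ indexLists e, g k := rfl

theorem Psi_eq_genFun (n : ℕ) (q : ℂ) : Psi n q = genFun fun k => zBarT n k q := by
  ext1 e
  rw [coeff_Psi, coeff_genFun, indexLists, Finset.sum_image fun _ _ _ _ h => List.ofFn_injective h]
  rfl

theorem genFun_congr {g g' : List ℕ → ℂ[X]} (h : ∀ k, (∀ a ∈ k, 1 ≤ a) → g k = g' k) :
    genFun g = genFun g' := by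
  ext1 e
  exact Finset.sum_congr rfl fun k hk => h k (mem_indexLists.1 hk).1

theorem genFun_add (g g' : List ℕ → ℂ[X]) : genFun (fun k => g k + g' k) = genFun g + genFun g' := by
  ext1 e
  simp only [map_add, coeff_genFun, Finset.sum_add_distrib]

theorem genFun_mul_left (c : ℂ[X]) (g : List ℕ → ℂ[X]) :
    genFun (fun k => c * g k) = MvPowerSeries.C c * genFun g := by
  ext1 e
  simp only [MvPowerSeries.coeff_C_mul, coeff_genFun, Finset.mul_sum]

/-- The positive integers with exponent `e` (there is at most one). -/
noncomputable def entries (e : Fin 3 →₀ ℕ) : Finset ℕ :=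
  (Finset.range (e 0 + 3)).filter fun a => 1 ≤ a ∧ entryExp a = e

theorem mem_entries {e : Fin 3 →₀ ℕ} {a : ℕ} : a ∈ entries e ↔ 1 ≤ a ∧ entryExp a = e := by
  rw [entries, Finset.mem_filter, Finset.mem_range, and_iff_right_iff_imp]
  rintro ⟨_, rfl⟩
  rw [entryExp]
  split_ifs with h
  · simp
    omega
  · omega

/-- The generating function of a function on positive integers, seen as multi-indices of
depth `1`. -/
noncomputable def entryGenFun (f : ℕ → ℂ) : MvPowerSeries (Fin 3) ℂ[X] := fun e =>
  ∑ a ∈ entries e, C (f a)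

theorem coeff_entryGenFun (f : ℕ → ℂ) (e : Fin 3 →₀ ℕ) :
    MvPowerSeries.coeff e (entryGenFun f) = ∑ a ∈ entries e, C (f a) := rfl

theorem genFun_cons {g h : List ℕ → ℂ[X]} {f : ℕ → ℂ} (h0 : g [] = 0)
    (h1 : ∀ a k, 1 ≤ a → (∀ b ∈ k, 1 ≤ b) → g (a :: k) = C (f a) * h k) :
    genFun g = entryGenFun f * genFun h := by
  ext1 e
  rw [MvPowerSeries.coeff_mul, coeff_genFun]
  simp only [coeff_genFun, coeff_entryGenFun, Finset.sum_mul_sum, ← Finset.sum_product']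
  rw [Finset.sum_sigma']
  symm
  -- Consing misses only the empty list, whose term vanishes by `h0`.
  apply Finset.sum_bij_ne_zero (fun x _ _ => x.2.1 :: x.2.2)
  · rintro ⟨p, a, k⟩ hx _
    simp only [Finset.mem_sigma, Finset.mem_product, mem_entries, mem_indexLists,
      Finset.HasAntidiagonal.mem_antidiagonal] at hx
    obtain ⟨hp, ⟨ha, ha'⟩, hk, hk'⟩ := hx
    rw [mem_indexLists, listExp_cons, ha', hk', hp]
    simpa using ⟨ha, hk⟩
  · rintro ⟨p, a, k⟩ hx _ ⟨p', a', k'⟩ hx' _ heq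
    simp only [Finset.mem_sigma, Finset.mem_product, mem_entries, mem_indexLists] at hx hx'
    simp only [List.cons.injEq] at heq
    obtain ⟨rfl, rfl⟩ := heq
    have : p = p' := Prod.ext (hx.2.1.2.symm.trans hx'.2.1.2) (hx.2.2.2.symm.trans hx'.2.2.2)
    rw [this]
  · intro l hl hne
    rcases l with _ | ⟨a, k⟩
    · exact absurd h0 hne
    · rw [mem_indexLists, listExp_cons] at hl
      obtain ⟨hpos, he⟩ := hl
      have ha : 1 ≤ a := hpos a (by simp)
      have hk : ∀ b ∈ k, 1 ≤ b := fun b hb => hpos b (by simp [hb])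
      refine ⟨⟨(entryExp a, listExp k), a, k⟩, ?_, ?_, rfl⟩
      · simp only [Finset.mem_sigma, Finset.mem_product, mem_entries, mem_indexLists,
          Finset.HasAntidiagonal.mem_antidiagonal]
        exact ⟨he, ⟨ha, trivial⟩, hk, trivial⟩
      · rwa [← h1 a k ha hk]
  · rintro ⟨p, a, k⟩ hx _
    simp only [Finset.mem_sigma, Finset.mem_product, mem_entries, mem_indexLists] at hx
    exact (h1 a k hx.2.1.1 hx.2.2.1).symm

theorem entries_eq (e : Fin 3 →₀ ℕ) : entries e =
    if e = Finsupp.single 1 1 then {1} else if e 1 = 0 ∧ e 2 = 1 then {e 0 + 2} else ∅ := by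
  ext a
  rw [mem_entries]
  split_ifs with h1 h2
  · subst h1
    rw [Finset.mem_singleton, entryExp]
    split_ifs with h
    · have := DFunLike.congr_fun (F := Fin 3 →₀ ℕ) (f := Finsupp.single 0 (a - 2) + Finsupp.single 2 1)
        (g := Finsupp.single 1 1)
      constructor
      · rintro ⟨_, h3⟩
        simpa using this h3 1
      · omega
    · simp
      omega
  · rw [Finset.mem_singleton]
    constructor
    · rintro ⟨ha, rfl⟩
      rw [entryExp] at h1 ⊢
      split_ifs at h1 ⊢ with h
      · simp
        omega
      · exact absurd rfl h1
    · rintro rfl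
      refine ⟨by omega, ?_⟩
      ext i
      fin_cases i <;> simp [entryExp, h2]
  · simp only [Finset.notMem_empty, iff_false]
    rintro ⟨ha, rfl⟩
    rw [entryExp] at h1 h2
    split_ifs at h1 h2 with h
    · simp at h2
    · exact h1 rfl

/-- The series is f(1) u₂ + f(2) u₃/(1 - r u₁): entry 1 gives u₂, and the entries a ≥ 2 give
u₁^(a-2) u₃ with geometric coefficients. -/
theorem entryGenFun_mul {f : ℕ → ℂ} {r : ℂ} (hf : ∀ a, 2 ≤ a → f (a + 1) = r * f a) :
    entryGenFun f * (1 - MvPowerSeries.C (C r) * u 0) =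
      MvPowerSeries.C (C (f 1)) * u 1 * (1 - MvPowerSeries.C (C r) * u 0) +
        MvPowerSeries.C (C (f 2)) * u 2 := by
  set Q : MvPowerSeries (Fin 3) ℂ[X] := entryGenFun f - MvPowerSeries.C (C (f 1)) * u 1 with hQ
  have hcoeff : ∀ e, MvPowerSeries.coeff e Q =
      if e 1 = 0 ∧ e 2 = 1 then C (f (e 0 + 2)) else 0 := by
    intro e
    rw [hQ, map_sub, coeff_entryGenFun, entries_eq, MvPowerSeries.coeff_C_mul, u,
      MvPowerSeries.coeff_X]
    by_cases h : e = Finsupp.single 1 1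
    · subst h
      simp
    · rw [if_neg h, if_neg h]
      split_ifs <;> simp
  have hmain : Q - Q * (MvPowerSeries.C (C r) * u 0) = MvPowerSeries.C (C (f 2)) * u 2 := by
    ext1 e
    have hmul : MvPowerSeries.coeff e (Q * (MvPowerSeries.C (C r) * u 0)) =
        C r * if Finsupp.single 0 1 ≤ e then
          MvPowerSeries.coeff (e - Finsupp.single 0 1) Q else 0 := by
      rw [mul_left_comm, MvPowerSeries.coeff_C_mul, u, MvPowerSeries.X_def,
        MvPowerSeries.coeff_mul_monomial]
      simp
    rw [map_sub, hmul, hcoeff, hcoeff, MvPowerSeries.coeff_C_mul, u, MvPowerSeries.coeff_X]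
    have hle : Finsupp.single 0 1 ≤ e ↔ 1 ≤ e 0 := by simp
    have he : e = Finsupp.single 2 1 ↔ e 0 = 0 ∧ e 1 = 0 ∧ e 2 = 1 := by
      simp [Finsupp.ext_iff, Fin.forall_fin_succ]
    simp only [hle, he, Finsupp.coe_tsub, Pi.sub_apply]
    by_cases h : e 1 = 0 ∧ e 2 = 1
    · rcases Nat.eq_zero_or_pos (e 0) with h0 | h0
      · simp [h, h0]
      · have h3 : e 0 - 1 + 2 + 1 = e 0 + 2 := by omega
        have h4 := hf (e 0 - 1 + 2) (by omega)
        rw [h3] at h4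
        have h5 : 1 ≤ e 0 := h0
        have h6 : e 0 ≠ 0 := by omega
        simp [h, h5, h6, h4]
    · simp [h]
  rw [hQ] at hmain
  linear_combination hmain

end InterpolatedHarmonic

/-! ### The quadratic factors and their product -/

namespace InterpolatedHarmonic

open Polynomial

theorem factor_succ {q : ℂ} (N : ℕ) {a : ℕ} (ha : 1 ≤ a) :
    factor q N (a + 1) = q ^ N / (1 - q ^ N) * factor q N a := by
  obtain ⟨a, rfl⟩ := Nat.exists_eq_add_of_le' ha
  simp only [factor, Nat.add_sub_cancel, add_mul, one_mul, pow_add, pow_one, div_eq_mul_inv,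
    mul_inv]
  ring

/-- The quadratic polynomial `(1 + u₁) x² - (1 + u₁ + 1 - t u₂ + t (u₃ - u₁ u₂)) x + (1 - t u₂)`. -/
noncomputable def quad (t : ℂ[X]) (x : ℂ) : MvPowerSeries (Fin 3) ℂ[X] :=
  (1 + u 0) * MvPowerSeries.C (C x) ^ 2 -
    ((1 + u 0) + (1 - MvPowerSeries.C t * u 1) + MvPowerSeries.C t * (u 2 - u 0 * u 1)) *
      MvPowerSeries.C (C x) + (1 - MvPowerSeries.C t * u 1)

theorem quad_eq {q : ℂ} {N : ℕ} (h : q ^ N ≠ 1) (t : ℂ[X]) :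
    quad t (q ^ N) = MvPowerSeries.C (C (1 - q ^ N)) ^ 2 *
      (1 - MvPowerSeries.C (C (q ^ N / (1 - q ^ N))) * u 0) *
        (1 - MvPowerSeries.C t * entryGenFun (factor q N)) := by
  have h1 : (1 : ℂ) - q ^ N ≠ 0 := sub_ne_zero.2 h.symm
  have hW := entryGenFun_mul (f := factor q N) (r := q ^ N / (1 - q ^ N))
    fun a ha => factor_succ N (by omega)
  have e1 : factor q N 1 = (1 - q ^ N)⁻¹ := by simp [factor]
  have e2 : factor q N 2 = q ^ N * (1 - q ^ N)⁻¹ ^ 2 := by simp [factor, div_eq_mul_inv]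
  rw [e1, e2, div_eq_mul_inv] at hW
  rw [quad, div_eq_mul_inv]
  have hy : (MvPowerSeries.C (C (1 - q ^ N)) : MvPowerSeries (Fin 3) ℂ[X]) *
      MvPowerSeries.C (C (1 - q ^ N)⁻¹) = 1 := by
    rw [← map_mul, ← map_mul, mul_inv_cancel₀ h1, map_one, map_one]
  have hx : (MvPowerSeries.C (C (1 - q ^ N)) : MvPowerSeries (Fin 3) ℂ[X]) =
      1 - MvPowerSeries.C (C (q ^ N)) := by
    rw [map_sub, map_sub, map_one, map_one]
  -- What remains is an identity in a commutative ring, using only D y = 1, x = 1 - D and the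
  -- relation `hW` for W.
  simp only [map_mul, map_pow] at hW ⊢
  simp only [map_pow] at hx
  generalize (MvPowerSeries.C (C (1 - q ^ N)) : MvPowerSeries (Fin 3) ℂ[X]) = D at *
  generalize (MvPowerSeries.C (C (1 - q ^ N)⁻¹) : MvPowerSeries (Fin 3) ℂ[X]) = y at *
  generalize (MvPowerSeries.C (C q) : MvPowerSeries (Fin 3) ℂ[X]) ^ N = x at *
  generalize entryGenFun (factor q N) = W at *
  generalize (MvPowerSeries.C t : MvPowerSeries (Fin 3) ℂ[X]) = T at *
  have hDW : D ^ 2 * (1 - x * y * u 0) * W = D * u 1 - x * u 0 * u 1 + x * u 2 := by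
    linear_combination D ^ 2 * hW + (D * u 1 - x * u 0 * u 1 * (D * y + 1)
      + x * u 2 * (D * y + 1)) * hy
  have hx' : x = 1 - D := by rw [hx]; ring
  subst hx'
  linear_combination T * hDW + (D * (1 - D) * u 0) * hy

/-- The prefactor in `quad_eq` does not depend on t, so it is common to both sides of the recursion.
-/
theorem quad_mul_genFun_succ {q : ℂ} {N : ℕ} (hN : 1 ≤ N) (h : q ^ N ≠ 1) :
    quad X (q ^ N) * genFun (fun k => zBarT (N + 1) k q) =
      quad (X - 1) (q ^ N) * genFun fun k => zBarT N k q := by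
  have h1 : genFun (fun k => zBarT (N + 1) k q) =
      genFun (fun k => zBarT N k q) + genFun (topSum N q) := by
    rw [← genFun_add]
    exact genFun_congr fun k _ => zBarT_succ hN q k
  have h2 : genFun (topSum N q) = entryGenFun (factor q N) *
      (genFun (fun k => zBarT N k q) + MvPowerSeries.C X * genFun (topSum N q)) := by
    rw [← genFun_mul_left, ← genFun_add]
    exact genFun_cons rfl fun a k ha hk => topSum_cons h ha k hk
  rw [quad_eq h, quad_eq h, h1, map_sub MvPowerSeries.C X 1, map_one MvPowerSeries.C]
  linear_combination (MvPowerSeries.C (C (1 - q ^ N)) ^ 2 *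
      (1 - MvPowerSeries.C (C (q ^ N / (1 - q ^ N))) * u 0)) * h2

theorem genFun_zBarT_one (q : ℂ) : genFun (fun k => zBarT 1 k q) = 1 := by
  classical
  ext1 e
  rw [coeff_genFun, MvPowerSeries.coeff_one]
  split_ifs with he
  · subst he
    rw [Finset.sum_eq_single []]
    · exact zBarT_nil 1 q
    · rintro (_ | ⟨a, k⟩) _ hne
      · exact absurd rfl hne
      · exact zBarT_one_cons a k q
    · intro hnil
      exact absurd (mem_indexLists.2 ⟨by simp, by simp [listExp]⟩) hnil
  · apply Finset.sum_eq_zero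
    rintro (_ | ⟨a, k⟩) hk
    · exact absurd ((mem_indexLists.1 hk).2.symm.trans (by simp [listExp])) he
    · exact zBarT_one_cons a k q

theorem prod_quad_mul_genFun {n : ℕ} {q : ℂ} (hq : IsPrimitiveRoot q n) {m : ℕ} (hm : 1 ≤ m)
    (hmn : m ≤ n) :
    (∏ i ∈ Finset.Ico 1 m, quad X (q ^ i)) * genFun (fun k => zBarT m k q) =
      ∏ i ∈ Finset.Ico 1 m, quad (X - 1) (q ^ i) := by
  induction m, hm using Nat.le_induction with
  | base => simp [genFun_zBarT_one]
  | succ m hm ih =>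
    rw [Finset.prod_Ico_succ_top hm, Finset.prod_Ico_succ_top hm, ← ih (by omega), mul_assoc,
      quad_mul_genFun_succ hm (hq.pow_ne_one_of_pos_of_lt (by omega) (by omega))]
    ring

/-- The product formula needs roots of a quadratic, hence the passage to an algebraic closure of the
fraction field, with A = 1 + u₁, B = 1 - t u₂, T = t (u₃ - u₁u₂). The condition t ≠ 0 makes T
nonzero. -/
theorem prod_quad_eq {n : ℕ} (hn : 1 ≤ n) {q : ℂ} (hq : IsPrimitiveRoot q n) {t : ℂ[X]}
    (ht : t ≠ 0) : ∏ i ∈ Finset.Ico 1 n, quad t (q ^ i) = n * U n t := by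
  have : IsDomain (MvPowerSeries (Fin 3) ℂ[X]) := NoZeroDivisors.to_isDomain _
  let K := AlgebraicClosure (FractionRing (MvPowerSeries (Fin 3) ℂ[X]))
  let φ : MvPowerSeries (Fin 3) ℂ[X] →+* K :=
    (algebraMap (FractionRing (MvPowerSeries (Fin 3) ℂ[X])) K).comp (algebraMap _ _)
  have hφ : Function.Injective φ :=
    (algebraMap (FractionRing (MvPowerSeries (Fin 3) ℂ[X])) K).injective.comp
      (IsFractionRing.injective _ _)
  let ψ : ℂ →+* K := φ.comp ((MvPowerSeries.C (σ := Fin 3)).comp (C : ℂ →+* ℂ[X]))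
  have : CharZero K := charZero_of_injective_ringHom ψ.injective
  have hψ : ∀ c : ℂ, φ (MvPowerSeries.C (C c)) = ψ c := fun _ => rfl
  have hA : φ (1 + u 0) ≠ 0 := by
    rw [map_ne_zero_iff φ hφ]
    intro h0
    have := congrArg MvPowerSeries.constantCoeff h0
    simp at this
  have hT : φ (MvPowerSeries.C t * (u 2 - u 0 * u 1)) ≠ 0 := by
    rw [map_ne_zero_iff φ hφ]
    refine mul_ne_zero ?_ ?_
    · intro h0
      exact ht (MvPowerSeries.C_injective (h0.trans (map_zero _).symm))
    · intro h0
      have := congrArg (MvPowerSeries.coeff (Finsupp.single 2 1)) h0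
      rw [map_sub, MvPowerSeries.coeff_index_single_self_X, u, u, MvPowerSeries.X_def,
        MvPowerSeries.coeff_monomial_mul] at this
      simp at this
  have hU : φ (U n t) = lucasSum n (φ (1 + u 0)) (φ (1 - MvPowerSeries.C t * u 1))
      (φ (MvPowerSeries.C t * (u 2 - u 0 * u 1))) := by
    rw [U, map_sum, lucasSum]
    refine Finset.sum_congr rfl fun p _ => ?_
    rw [map_mul, map_mul, map_mul, map_pow, map_pow, map_pow, map_mul MvPowerSeries.C, map_mul φ,
      hψ, map_pow, map_pow φ, map_mul φ, mul_pow]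
    simp only [map_mul ψ, map_div₀ ψ, map_sub ψ, map_one, map_natCast]
    ring
  apply hφ
  rw [map_mul, map_natCast, hU, ← prod_quadratic_roots_of_unity hn
    (hq.map_of_injective ψ.injective) hA hT, map_prod]
  refine Finset.prod_congr rfl fun i _ => ?_
  rw [← map_pow, ← hψ, quad]
  simp only [map_add, map_sub, map_mul, map_pow]

theorem isUnit_quad (t : ℂ[X]) {x : ℂ} (hx : x ≠ 1) : IsUnit (quad t x) := by
  rw [MvPowerSeries.isUnit_iff_constantCoeff]
  have h : MvPowerSeries.constantCoeff (quad t x) = C ((x - 1) ^ 2) := by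
    simp [quad]
    ring
  rw [h]
  exact ((isUnit_iff_ne_zero.2 (sub_ne_zero.2 hx)).pow 2).map C

/-- Each quadratic has constant term (q^i - 1)², a unit, so their product n U is a unit. -/
theorem isUnit_U {n : ℕ} (hn : 1 ≤ n) {q : ℂ} (hq : IsPrimitiveRoot q n) {t : ℂ[X]}
    (ht : t ≠ 0) : IsUnit (U n t) := by
  refine isUnit_of_mul_isUnit_right (x := (n : MvPowerSeries (Fin 3) ℂ[X])) ?_
  rw [← prod_quad_eq hn hq ht]
  refine Finset.prod_induction _ IsUnit (fun _ _ => IsUnit.mul) isUnit_one fun i hi => ?_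
  have hi := Finset.mem_Ico.1 hi
  exact isUnit_quad t (hq.pow_ne_one_of_pos_of_lt (by omega) hi.2)

end InterpolatedHarmonic

theorem theorem1p3 (n : ℕ) (hn : 1 ≤ n) (ζ : ℂ) (hζ : IsPrimitiveRoot ζ n) :
    IsUnit (InterpolatedHarmonic.U n Polynomial.X) ∧
      InterpolatedHarmonic.Psi n ζ =
        InterpolatedHarmonic.U n (Polynomial.X - 1) *
          Ring.inverse (InterpolatedHarmonic.U n Polynomial.X) := by
  have hU := InterpolatedHarmonic.isUnit_U hn hζ Polynomial.X_ne_zero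
  refine ⟨hU, ?_⟩
  have h := InterpolatedHarmonic.prod_quad_mul_genFun hζ hn le_rfl
  rw [InterpolatedHarmonic.prod_quad_eq hn hζ Polynomial.X_ne_zero,
    InterpolatedHarmonic.prod_quad_eq hn hζ (by simpa using Polynomial.X_sub_C_ne_zero (1 : ℂ)), ← InterpolatedHarmonic.Psi_eq_genFun,
    mul_assoc] at h
  have hn0 : (n : MvPowerSeries (Fin 3) (Polynomial ℂ)) ≠ 0 := by
    rw [← map_natCast MvPowerSeries.C n, ← map_zero MvPowerSeries.C,
      Ne, MvPowerSeries.C_inj, Nat.cast_eq_zero]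
    omega
  have h' := mul_left_cancel₀ hn0 h
  rw [← h', mul_right_comm, Ring.mul_inverse_cancel _ hU, one_mul]
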